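/- Let $H$ be a finite-dimensional complex Hilbert space, $L(H)$ the algebra of linear operators on $H$, and $L(H)_*$ the space of linear functionals on $L(H)$. Let $V$ be a multiplicative partial isometry on $H$, i.e. an operator $V$ on $H\otimes H$, identified with an element of $L(H)\otimes L(H)$, such that $VV^*V=V$ and such that, on $H\otimes H\otimes H$, $$V_{23}V_{12}=V_{12}V_{13}V_{23},\qquad V_{13}V_{23}V_{23}^*=V_{12}^*V_{12}V_{13},$$ $$V_{12}V_{12}^*V_{23}=V_{23}V_{12}V_{12}^*,\qquad V_{12}V_{23}^*V_{23}=V_{23}^*V_{23}V_{12}.$$ Define the right leg and the left leg of $V$ by $$A=\{(\omega\otimes\mathrm{id})(V):\omega\in L(H)_*\},\qquad \hat A=\{(\mathrm{id}\otimes\omega)(V):\omega\in L(H)_*\}.$$ Call $V$ unital if there are functionals $\varepsilon,\hat\varepsilon\in L(H)_*$ such that $(\hat\varepsilon\otimes\mathrm{id})(V)$ is a two-sided unit for $A$ and $(\mathrm{id}\otimes\varepsilon)(V)$ is a two-sided unit for $\hat A$; let $1_A$ denote the unit of $A$ (which need not be $\mathrm{id}_H$). Put $$A^R=\{(\omega\otimes\mathrm{id})(V^*V):\omega\in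 L(H)_*\},$$ let $(A^R)'$ be its commutant in $L(H)$, and, writing $V=\sum_i a_i\otimes b_i$, put $C(V)=\{\sum_i b_iXa_i: X\in L(H)\}$. Call a unital $V$ regular if $$C(V)=(A^R)'\cap 1_A\,L(H)\,1_A .$$ Then $A$ and $\hat A$ are both $*$-subalgebras of $L(H)$ (not required to contain $\mathrm{id}_H$) if and only if $V$ is unital and regular. -/

import Mathlib

open scoped TensorProduct

noncomputable section

namespace MPI

variable {H : Type*} [NormedAddCommGroup H] [InnerProductSpace ℂ H] [FiniteDimensional ℂ H]

/-- The algebra `L(H)` of linear operators on the finite dimensional Hilbert space `H`. -/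
abbrev Op (H : Type*) [NormedAddCommGroup H] [InnerProductSpace ℂ H] := H →ₗ[ℂ] H

/-- Operators on the Hilbert space `H ⊗ H` (with its Hilbert tensor product inner product). -/
abbrev Op₂ (H : Type*) [NormedAddCommGroup H] [InnerProductSpace ℂ H] := (H ⊗[ℂ] H) →ₗ[ℂ] (H ⊗[ℂ] H)

/-- Operators on the threefold tensor product, bracketed as `H ⊗ (H ⊗ H)`. -/
abbrev Op₃ (H : Type*) [NormedAddCommGroup H] [InnerProductSpace ℂ H] :=
  (H ⊗[ℂ] (H ⊗[ℂ] H)) →ₗ[ℂ] (H ⊗[ℂ] (H ⊗[ℂ] H))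

/-- The adjoint `V^*` on `H ⊗ H`. -/
def adj (V : Op₂ H) : Op₂ H := LinearMap.adjoint V

/-- `T ↦ T₁₂`: `T` acting on the first and second tensor factors. -/
def leg12 (T : Op₂ H) : Op₃ H :=
  (TensorProduct.assoc ℂ H H H).toLinearMap ∘ₗ T.rTensor H ∘ₗ
    (TensorProduct.assoc ℂ H H H).symm.toLinearMap

/-- `T ↦ T₂₃`: `T` acting on the second and third tensor factors. -/
def leg23 (T : Op₂ H) : Op₃ H := T.lTensor H

/-- `T ↦ T₁₃`: `T` acting on the first and third tensor factors
(exchange the first two factors, act by `T₂₃`, exchange back). -/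
def leg13 (T : Op₂ H) : Op₃ H :=
  (TensorProduct.leftComm ℂ H H H).toLinearMap ∘ₗ leg23 T ∘ₗ
    (TensorProduct.leftComm ℂ H H H).toLinearMap

/-- `V` is a multiplicative partial isometry (MPI). -/
structure IsMPI (V : Op₂ H) : Prop where
  partial_isometry : V * adj V * V = V
  pentagon : leg23 V * leg12 V = leg12 V * leg13 V * leg23 V
  hexa1 : leg13 V * leg23 V * leg23 (adj V) = leg12 (adj V) * leg12 V * leg13 V
  hexa2 : leg12 V * leg12 (adj V) * leg23 V = leg23 V * leg12 V * leg12 (adj V)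
  hexa3 : leg12 V * leg23 (adj V) * leg23 V = leg23 (adj V) * leg23 V * leg12 V

/-- `V` viewed as an element of `L(H) ⊗ L(H)`. -/
def toTensor (V : Op₂ H) : Op H ⊗[ℂ] Op H := (homTensorHomEquiv ℂ H H H H).symm V

/-- `lam V ω = (ω ⊗ id)(V)`. -/
def lam (V : Op₂ H) : Module.Dual ℂ (Op H) →ₗ[ℂ] Op H :=
  (TensorProduct.lid ℂ (Op H)).toLinearMap ∘ₗ
    LinearMap.applyₗ (toTensor V) ∘ₗ LinearMap.rTensorHom (Op H)

/-- `rho V ω = (id ⊗ ω)(V)`. -/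
def rho (V : Op₂ H) : Module.Dual ℂ (Op H) →ₗ[ℂ] Op H :=
  (TensorProduct.rid ℂ (Op H)).toLinearMap ∘ₗ
    LinearMap.applyₗ (toTensor V) ∘ₗ LinearMap.lTensorHom (Op H)

/-- The right leg `A` of `V`. -/
def rightLeg (V : Op₂ H) : Submodule ℂ (Op H) := LinearMap.range (lam V)

/-- The left leg `Â` of `V`. -/
def leftLeg (V : Op₂ H) : Submodule ℂ (Op H) := LinearMap.range (rho V)

/-- The subspace `B` is a `*`-subalgebra of `L(H)`, not necessarily containing `id_H`. -/
def IsStarSubalgebra (B : Submodule ℂ (Op H)) : Prop :=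
  ∃ S : NonUnitalStarSubalgebra ℂ (Op H), (S : Set (Op H)) = (B : Set (Op H))

/-- `e` is an element of `B` which is a two-sided unit for `B`. -/
def IsUnitOf (B : Submodule ℂ (Op H)) (e : Op H) : Prop :=
  e ∈ B ∧ ∀ b ∈ B, e * b = b ∧ b * e = b

/-- `V` is unital: some `lam V ε'` is a two-sided unit for the right leg and some `rho V ε` is a
two-sided unit for the left leg. -/
def IsUnital (V : Op₂ H) : Prop :=
  ∃ ε ε' : Module.Dual ℂ (Op H), IsUnitOf (rightLeg V) (lam V ε') ∧ IsUnitOf (leftLeg V) (rho V ε)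

/-- The linear map `X ↦ V₂ X V₁`, i.e. `X ↦ ∑ b X a` for `V = ∑ a ⊗ b`. -/
def sandwich (V : Op₂ H) : Op H →ₗ[ℂ] Op H :=
  TensorProduct.lift
    (LinearMap.mk₂ ℂ
      (fun a b : Op H => LinearMap.mulLeft ℂ b ∘ₗ LinearMap.mulRight ℂ a)
      (fun _ _ _ => by ext; simp [mul_add])
      (fun _ _ _ => by ext; simp)
      (fun _ _ _ => by ext; simp)
      (fun _ _ _ => by ext; simp))
    (toTensor V)

/-- The subspace `C(V) = V₂ L(H) V₁`. -/
def C (V : Op₂ H) : Submodule ℂ (Op H) := LinearMap.range (sandwich V)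

/-- `A^R = {(ω ⊗ id)(V^* V)}`. -/
def AR (V : Op₂ H) : Submodule ℂ (Op H) := rightLeg (adj V * V)

/-- Regularity: `C(V) = (A^R)' ∩ e L(H) e`, where `e` is the unit of the right leg of `V`. -/
def IsRegular (V : Op₂ H) : Prop :=
  ∃ e : Op H, IsUnitOf (rightLeg V) e ∧
    (C V : Set (Op H)) = Set.centralizer (AR V : Set (Op H)) ∩ {Y | ∃ T : Op H, Y = e * T * e}

end MPI

end

noncomputable section
namespace MPI
variable {H : Type*} [NormedAddCommGroup H] [InnerProductSpace ℂ H] [FiniteDimensional ℂ H]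

/-! ### Operators on tensor powers as tensors -/

/-! Every identity between operators on the threefold tensor product yields identities in `L(H)`:
write the operators as sums of elementary tensors and apply a trilinear map (functionals on some
factors, reversed products such as `h X g` on others). The axioms are first solved for short forms
such as `V₁₃V₂₃ = V₁₂*V₂₃V₁₂` and `V₁₂V₂₃* = V₂₃*V₁₂V₁₃`. The former, and its mirror image for `Â`,
make the legs algebras.

Unital and regular implies star closed: slicing the axioms shows that the two units coincide in a
self-adjoint `e` (`IsMPI.units_eq`). Hence `(A^R)' ∩ e L(H) e`, which is `C(V)`, is closed under the
adjoint. By `IsMPI.lam_adj_sandwich`, certain slices of `V*` are also slices of `V*(Y ⊗ 1)V` with `Y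
∈ C(V)`. Replacing `Y` by `Y*` shows that the adjoints of these slices are again slices of `V*`, so
the slices themselves lie in `A`. Unitality shows by duality that they span all of `A*`. The left
leg is symmetric.

Star closed implies unital and regular: a finite-dimensional `*`-algebra of operators has a unit.
The inclusion of `C(V)` in the commutant is `V₁₃*V₁₃V₂₃ = V₂₃V₁₂*V₁₂`. For the converse, star
closure of `A` gives an antimultiplicative map `S` on `Â` with `(S ⊗ id)(V*) = V`; with it, an
explicit `X` satisfying `V₂XV₁ = Y` is built for each `Y` of the commutant corner
(`IsMPI.mem_C_of_commute`). -/

theorem homTensorHomEquiv_tmul {K : Type*} [AddCommGroup K] [Module ℂ K] [FiniteDimensional ℂ K]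
    (f : Op H) (g : K →ₗ[ℂ] K) :
    homTensorHomEquiv ℂ H K H K (f ⊗ₜ g) = TensorProduct.map f g := by
  simp

theorem exists_linear₂ {M : Type*} [AddCommGroup M] [Module ℂ M] (Φ : Op H → Op H → M)
    (h₁ : ∀ g, IsLinearMap ℂ fun f => Φ f g) (h₂ : ∀ f, IsLinearMap ℂ fun g => Φ f g) :
    ∃ L : Op₂ H →ₗ[ℂ] M, ∀ f g, L (TensorProduct.map f g) = Φ f g := by
  refine ⟨TensorProduct.lift (LinearMap.mk₂ ℂ Φ (fun f f' g => (h₁ g).map_add f f')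
    (fun c f g => (h₁ g).map_smul c f) (fun f g g' => (h₂ f).map_add g g')
    (fun c f g => (h₂ f).map_smul c g)) ∘ₗ (homTensorHomEquiv ℂ H H H H).symm.toLinearMap, ?_⟩
  intro f g
  rw [← homTensorHomEquiv_tmul]
  simp only [LinearMap.comp_apply, LinearEquiv.coe_coe, LinearEquiv.symm_apply_apply]
  simp

theorem exists_linear₃ {M : Type*} [AddCommGroup M] [Module ℂ M] (Φ : Op H → Op H → Op H → M)
    (h₁ : ∀ g h, IsLinearMap ℂ fun f => Φ f g h) (h₂ : ∀ f h, IsLinearMap ℂ fun g => Φ f g h)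
    (h₃ : ∀ f g, IsLinearMap ℂ fun h => Φ f g h) :
    ∃ L : Op₃ H →ₗ[ℂ] M, ∀ f g h, L (TensorProduct.map f (TensorProduct.map g h)) = Φ f g h := by
  let Ψ : Op H →ₗ[ℂ] Op H →ₗ[ℂ] Op H →ₗ[ℂ] M :=
    LinearMap.mk₂ ℂ (fun f g => (h₃ f g).mk')
      (fun f f' g => by ext h; exact (h₁ g h).map_add f f')
      (fun c f g => by ext h; exact (h₁ g h).map_smul c f)
      (fun f g g' => by ext h; exact (h₂ f h).map_add g g')
      (fun c f g => by ext h; exact (h₂ f h).map_smul c g)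
  let Θ : Op H →ₗ[ℂ] Op₂ H →ₗ[ℂ] M :=
    LinearMap.lcomp ℂ M (homTensorHomEquiv ℂ H H H H).symm.toLinearMap ∘ₗ
      TensorProduct.uncurry (.id ℂ) (Op H) (Op H) M ∘ₗ Ψ
  refine ⟨TensorProduct.lift Θ ∘ₗ (homTensorHomEquiv ℂ H (H ⊗[ℂ] H) H (H ⊗[ℂ] H)).symm.toLinearMap, ?_⟩
  intro f g h
  rw [← homTensorHomEquiv_tmul f]
  simp only [LinearMap.comp_apply, LinearEquiv.coe_coe, LinearEquiv.symm_apply_apply]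
  simp only [TensorProduct.lift.tmul, Θ, LinearMap.comp_apply, LinearMap.lcomp_apply]
  rw [← homTensorHomEquiv_tmul g]
  simp only [LinearEquiv.coe_coe, LinearEquiv.symm_apply_apply]
  rfl

theorem exists_rep {K : Type*} [AddCommGroup K] [Module ℂ K] [FiniteDimensional ℂ K]
    (T : H ⊗[ℂ] K →ₗ[ℂ] H ⊗[ℂ] K) : ∃ (n : ℕ) (a : Fin n → Op H) (b : Fin n → K →ₗ[ℂ] K),
    T = ∑ i, TensorProduct.map (a i) (b i) := by
  obtain ⟨t, rfl⟩ := (homTensorHomEquiv ℂ H K H K).surjective T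
  obtain ⟨S, rfl⟩ := TensorProduct.exists_finset t
  refine ⟨S.card, fun i => (S.equivFin.symm i).1.1, fun i => (S.equivFin.symm i).1.2, ?_⟩
  rw [map_sum, ← Finset.sum_coe_sort, ← S.equivFin.symm.sum_comp]
  simp

/-! ### Slices and legs of an explicit sum -/

section Sum
variable {ι : Type*} [Fintype ι] (a b : ι → Op H)

theorem toTensor_sum :
    toTensor (∑ i, TensorProduct.map (a i) (b i)) = ∑ i, a i ⊗ₜ[ℂ] b i := by
  rw [toTensor, LinearEquiv.symm_apply_eq]
  simp

theorem lam_sum (ω : Module.Dual ℂ (Op H)) :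
    lam (∑ i, TensorProduct.map (a i) (b i)) ω = ∑ i, ω (a i) • b i := by
  simp [lam, toTensor_sum, map_sum]

theorem rho_sum (ω : Module.Dual ℂ (Op H)) :
    rho (∑ i, TensorProduct.map (a i) (b i)) ω = ∑ i, ω (b i) • a i := by
  simp [rho, toTensor_sum, map_sum]

theorem sandwich_sum (X : Op H) :
    sandwich (∑ i, TensorProduct.map (a i) (b i)) X = ∑ i, b i * (X * a i) := by
  simp [sandwich, toTensor_sum, map_sum]

end Sum

/-! ### Leg embeddings and adjoints -/

omit [FiniteDimensional ℂ H] in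
theorem leg12_map (f g : Op H) :
    leg12 (TensorProduct.map f g) = TensorProduct.map f (TensorProduct.map g 1) := by
  apply TensorProduct.ext_threefold'
  intro x y z
  simp [leg12]

omit [FiniteDimensional ℂ H] in
theorem leg23_map (f g : Op H) :
    leg23 (TensorProduct.map f g) = TensorProduct.map 1 (TensorProduct.map f g) := rfl

omit [FiniteDimensional ℂ H] in
theorem leg13_map (f g : Op H) :
    leg13 (TensorProduct.map f g) = TensorProduct.map f (TensorProduct.map 1 g) := by
  apply TensorProduct.ext_threefold'
  intro x y z
  simp [leg13, leg23]

theorem adj_map (f g : Op H) :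
    adj (TensorProduct.map f g) = TensorProduct.map (star f) (star g) :=
  TensorProduct.adjoint_map f g

theorem adj_mul (S T : Op₂ H) : adj (S * T) = adj T * adj S :=
  LinearMap.adjoint_comp S T

theorem adj_adj (T : Op₂ H) : adj (adj T) = T :=
  LinearMap.adjoint_adjoint T

/-- The adjoint as a conjugate linear map. -/
def adjₗ : Op₂ H →ₗ⋆[ℂ] Op₂ H where
  toFun := adj
  map_add' S T := map_add LinearMap.adjoint S T
  map_smul' c T := map_smulₛₗ LinearMap.adjoint c T

theorem adj_sum {ι : Type*} (s : Finset ι) (T : ι → Op₂ H) :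
    adj (∑ i ∈ s, T i) = ∑ i ∈ s, adj (T i) :=
  map_sum adjₗ T s

/-- The adjoint on the threefold tensor product, as the tensor product of adjoints. -/
def adj₃ : Op₃ H →ₗ⋆[ℂ] Op₃ H :=
  (homTensorHomEquiv ℂ H (H ⊗[ℂ] H) H (H ⊗[ℂ] H)).toLinearMap ∘ₛₗ
    (TensorProduct.map (starLinearEquiv ℂ (A := Op H)).toLinearMap adjₗ) ∘ₛₗ
    (homTensorHomEquiv ℂ H (H ⊗[ℂ] H) H (H ⊗[ℂ] H)).symm.toLinearMap

theorem adj₃_map (f : Op H) (T : Op₂ H) :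
    adj₃ (TensorProduct.map f T) = TensorProduct.map (star f) (adj T) := by
  have h : (homTensorHomEquiv ℂ H (H ⊗[ℂ] H) H (H ⊗[ℂ] H)).symm (TensorProduct.map f T) =
      f ⊗ₜ T := by
    rw [LinearEquiv.symm_apply_eq, homTensorHomEquiv_tmul]
  simp only [adj₃, LinearMap.comp_apply, LinearEquiv.coe_coe, h, TensorProduct.map_tmul,
    homTensorHomEquiv_tmul]
  rfl

theorem adj₃_mul (S T : Op₃ H) : adj₃ (S * T) = adj₃ T * adj₃ S := by
  obtain ⟨n, a, b, rfl⟩ := exists_rep S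
  obtain ⟨m, c, d, rfl⟩ := exists_rep T
  simp only [Finset.sum_mul_sum, map_sum, ← TensorProduct.map_mul, adj₃_map, star_mul, adj_mul]
  exact Finset.sum_comm

omit [FiniteDimensional ℂ H] in
theorem leg12_sum {ι : Type*} (s : Finset ι) (T : ι → Op₂ H) :
    leg12 (∑ i ∈ s, T i) = ∑ i ∈ s, leg12 (T i) :=
  map_sum (AddMonoidHom.mk' (leg12 (H := H)) fun S T => by
    simp [leg12, LinearMap.rTensor_add, LinearMap.comp_add, LinearMap.add_comp]) T s

omit [FiniteDimensional ℂ H] in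
theorem leg23_sum {ι : Type*} (s : Finset ι) (T : ι → Op₂ H) :
    leg23 (∑ i ∈ s, T i) = ∑ i ∈ s, leg23 (T i) :=
  map_sum (LinearMap.lTensorHom H) T s

omit [FiniteDimensional ℂ H] in
theorem leg13_sum {ι : Type*} (s : Finset ι) (T : ι → Op₂ H) :
    leg13 (∑ i ∈ s, T i) = ∑ i ∈ s, leg13 (T i) :=
  map_sum (AddMonoidHom.mk' (leg13 (H := H)) fun S T => by
    simp [leg13, leg23, LinearMap.lTensor_add, LinearMap.comp_add, LinearMap.add_comp]) T s

theorem leg12_mul (S T : Op₂ H) : leg12 (S * T) = leg12 S * leg12 T := by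
  obtain ⟨n, a, b, rfl⟩ := exists_rep S
  obtain ⟨m, c, d, rfl⟩ := exists_rep T
  simp [leg12_sum, Finset.sum_mul_sum, ← TensorProduct.map_mul, leg12_map]

omit [FiniteDimensional ℂ H] in
theorem leg23_mul (S T : Op₂ H) : leg23 (S * T) = leg23 S * leg23 T :=
  LinearMap.lTensor_mul _ _ _

theorem leg13_mul (S T : Op₂ H) : leg13 (S * T) = leg13 S * leg13 T := by
  obtain ⟨n, a, b, rfl⟩ := exists_rep S
  obtain ⟨m, c, d, rfl⟩ := exists_rep T
  simp [leg13_sum, Finset.sum_mul_sum, ← TensorProduct.map_mul, leg13_map]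

theorem adj₃_leg12 (T : Op₂ H) : adj₃ (leg12 T) = leg12 (adj T) := by
  obtain ⟨n, a, b, rfl⟩ := exists_rep T
  simp [leg12_sum, adj_sum, adj_map, adj₃_map, leg12_map]

theorem adj₃_leg23 (T : Op₂ H) : adj₃ (leg23 T) = leg23 (adj T) := by
  obtain ⟨n, a, b, rfl⟩ := exists_rep T
  simp [leg23_sum, adj_sum, adj_map, adj₃_map, leg23_map]

theorem adj₃_leg13 (T : Op₂ H) : adj₃ (leg13 T) = leg13 (adj T) := by
  obtain ⟨n, a, b, rfl⟩ := exists_rep T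
  simp [leg13_sum, adj_sum, adj_map, adj₃_map, leg13_map]

/-! ### Consequences of the axioms -/

namespace IsMPI
variable {V : Op₂ H} (hV : IsMPI V)
include hV

theorem mul_star_mul : V * adj V * V = V := hV.partial_isometry

theorem star_mul_mul_star : adj V * V * adj V = adj V := by
  simpa only [mul_assoc, adj_mul, adj_adj] using congrArg adj hV.mul_star_mul

theorem leg_hexa1 :
    leg13 V * leg23 V * leg23 (adj V) = leg12 (adj V) * leg12 V * leg13 V := hV.hexa1

theorem leg_hexa2 :
    leg12 V * leg12 (adj V) * leg23 V = leg23 V * leg12 V * leg12 (adj V) := hV.hexa2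

theorem leg_hexa3 :
    leg12 V * leg23 (adj V) * leg23 V = leg23 (adj V) * leg23 V * leg12 V := hV.hexa3

theorem leg12_pi : leg12 V * leg12 (adj V) * leg12 V = leg12 V := by
  rw [← leg12_mul, ← leg12_mul, hV.mul_star_mul]

theorem leg23_pi : leg23 V * leg23 (adj V) * leg23 V = leg23 V := by
  rw [← leg23_mul, ← leg23_mul, hV.mul_star_mul]

theorem leg12_pi_star : leg12 (adj V) * leg12 V * leg12 (adj V) = leg12 (adj V) := by
  rw [← leg12_mul, ← leg12_mul, hV.star_mul_mul_star]

theorem leg23_pi_star : leg23 (adj V) * leg23 V * leg23 (adj V) = leg23 (adj V) := by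
  rw [← leg23_mul, ← leg23_mul, hV.star_mul_mul_star]

/-- The final projection `V₂₃V₂₃*` can be inserted before `V₂₃`; the first hexagon axiom turns it
into `V₁₂*V₁₂` on the left, where the pentagon applies. On the right-hand side the third factor is
touched by `V₂₃` alone. -/
theorem leg13_mul_leg23 : leg13 V * leg23 V = leg12 (adj V) * leg23 V * leg12 V := by
  calc leg13 V * leg23 V = leg13 V * leg23 V * leg23 (adj V) * leg23 V := by
        rw [mul_assoc (leg13 V), mul_assoc (leg13 V), hV.leg23_pi]
    _ = leg12 (adj V) * (leg12 V * leg13 V * leg23 V) := by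
        rw [hV.leg_hexa1]; simp only [mul_assoc]
    _ = _ := by rw [← hV.pentagon, mul_assoc]

theorem leg12_mul_leg13 : leg12 V * leg13 V = leg23 V * leg12 V * leg23 (adj V) := by
  calc leg12 V * leg13 V = leg12 V * (leg12 (adj V) * leg12 V * leg13 V) := by
        simp only [← mul_assoc]; rw [hV.leg12_pi]
    _ = (leg12 V * leg13 V * leg23 V) * leg23 (adj V) := by
        rw [← hV.leg_hexa1]; simp only [mul_assoc]
    _ = _ := by rw [← hV.pentagon]

theorem leg12_mul_leg23_star :
    leg12 V * leg23 (adj V) = leg23 (adj V) * leg12 V * leg13 V := by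
  rw [mul_assoc, hV.leg12_mul_leg13]
  simp only [← mul_assoc]
  rw [← hV.leg_hexa3]
  simp only [mul_assoc]
  rw [← mul_assoc (leg23 (adj V)), hV.leg23_pi_star]

theorem leg12_star_mul_leg23 :
    leg12 (adj V) * leg23 V = leg13 V * leg23 V * leg12 (adj V) := by
  rw [hV.leg13_mul_leg23, mul_assoc (_ * _), mul_assoc (leg12 (adj V)),
    ← mul_assoc (leg23 V), ← hV.leg_hexa2]
  simp only [← mul_assoc]
  rw [hV.leg12_pi_star]

theorem leg13_star_mul_leg12_star :
    leg13 (adj V) * leg12 (adj V) = leg23 V * leg12 (adj V) * leg23 (adj V) := by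
  simpa only [mul_assoc, adj₃_mul, adj₃_leg12, adj₃_leg13, adj₃_leg23, adj_mul, adj_adj]
    using congrArg adj₃ hV.leg12_mul_leg13

/-- This is the commutation of `C(V)` with `A^R` before slicing; it also drives the antipode
computation. -/
theorem leg13_star_mul_leg13_mul_leg23 :
    leg13 (adj V) * leg13 V * leg23 V = leg23 V * (leg12 (adj V) * leg12 V) := by
  have h : leg12 (adj V) * (leg23 (adj V) * leg23 V) =
      leg23 (adj V) * leg23 V * leg12 (adj V) := by
    simpa only [mul_assoc, adj₃_mul, adj₃_leg12, adj₃_leg13, adj₃_leg23, adj_mul, adj_adj]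
      using (congrArg adj₃ hV.leg_hexa3).symm
  calc leg13 (adj V) * leg13 V * leg23 V
      = (leg13 (adj V) * leg12 (adj V)) * (leg23 V * leg12 V) := by
        rw [mul_assoc, hV.leg13_mul_leg23]; simp only [mul_assoc]
    _ = leg23 V * (leg12 (adj V) * (leg23 (adj V) * leg23 V)) * leg12 V := by
        rw [hV.leg13_star_mul_leg12_star]; simp only [mul_assoc]
    _ = (leg23 V * leg23 (adj V) * leg23 V) * (leg12 (adj V) * leg12 V) := by
        rw [h]; simp only [mul_assoc]
    _ = _ := by rw [hV.leg23_pi]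

end IsMPI

/-! ### Slices -/

omit [FiniteDimensional ℂ H] in
theorem map_sum_left {ι : Type*} (s : Finset ι) (f : ι → Op H) (g : Op H) :
    TensorProduct.map (∑ i ∈ s, f i) g = ∑ i ∈ s, TensorProduct.map (f i) g :=
  map_sum ((TensorProduct.mapBilinear (.id ℂ) H H H H).flip g) f s

omit [FiniteDimensional ℂ H] in
theorem map_sum_right {ι : Type*} (s : Finset ι) (f : Op H) (g : ι → Op H) :
    TensorProduct.map f (∑ i ∈ s, g i) = ∑ i ∈ s, TensorProduct.map f (g i) :=
  map_sum (TensorProduct.mapBilinear (.id ℂ) H H H H f) g s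

/-- Expanding the first factors in a basis of `L(H)` turns the coefficients in the second factor
into slices by the coordinate functionals. -/
theorem exists_rep_lam (T : Op₂ H) : ∃ (n : ℕ) (a b : Fin n → Op H),
    T = ∑ i, TensorProduct.map (a i) (b i) ∧ ∀ i, b i ∈ rightLeg T := by
  let e := Module.finBasis ℂ (Op H)
  refine ⟨_, e, fun k => lam T (e.coord k), ?_, fun k => ⟨_, rfl⟩⟩
  obtain ⟨n, a, b, rfl⟩ := exists_rep T
  simp only [lam_sum, map_sum_right]
  rw [Finset.sum_comm]
  refine Finset.sum_congr rfl fun i _ => ?_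
  simp only [TensorProduct.map_smul_right]
  simp only [← TensorProduct.map_smul_left, ← map_sum_left, Module.Basis.coord_apply, e.sum_repr]

theorem exists_rep_rho (T : Op₂ H) : ∃ (n : ℕ) (a b : Fin n → Op H),
    T = ∑ i, TensorProduct.map (a i) (b i) ∧ ∀ i, a i ∈ leftLeg T := by
  let e := Module.finBasis ℂ (Op H)
  refine ⟨_, fun k => rho T (e.coord k), e, ?_, fun k => ⟨_, rfl⟩⟩
  obtain ⟨n, a, b, rfl⟩ := exists_rep T
  simp only [rho_sum, map_sum_left]
  rw [Finset.sum_comm]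
  refine Finset.sum_congr rfl fun i _ => ?_
  simp only [TensorProduct.map_smul_left]
  simp only [← TensorProduct.map_smul_right, ← map_sum_right, Module.Basis.coord_apply, e.sum_repr]

theorem lam_sub (S T : Op₂ H) (ω : Module.Dual ℂ (Op H)) :
    lam (S - T) ω = lam S ω - lam T ω := by
  simp [lam, toTensor]

theorem rho_sub (S T : Op₂ H) (ω : Module.Dual ℂ (Op H)) :
    rho (S - T) ω = rho S ω - rho T ω := by
  simp [rho, toTensor]

theorem lam_finset_sum {ι : Type*} (s : Finset ι) (T : ι → Op₂ H) (ω : Module.Dual ℂ (Op H)) :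
    lam (∑ i ∈ s, T i) ω = ∑ i ∈ s, lam (T i) ω := by
  simp [lam, toTensor]

theorem rho_finset_sum {ι : Type*} (s : Finset ι) (T : ι → Op₂ H) (ω : Module.Dual ℂ (Op H)) :
    rho (∑ i ∈ s, T i) ω = ∑ i ∈ s, rho (T i) ω := by
  simp [rho, toTensor]

theorem lam_map (a b : Op H) (ω : Module.Dual ℂ (Op H)) :
    lam (TensorProduct.map a b) ω = ω a • b := by
  simpa using lam_sum (fun _ : Unit => a) (fun _ => b) ω

theorem rho_map (a b : Op H) (ω : Module.Dual ℂ (Op H)) :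
    rho (TensorProduct.map a b) ω = ω b • a := by
  simpa using rho_sum (fun _ : Unit => a) (fun _ => b) ω

theorem lam_ext {S T : Op₂ H} (h : ∀ ω, lam S ω = lam T ω) : S = T := by
  rw [← sub_eq_zero]
  obtain ⟨n, a, b, hab, hb⟩ := exists_rep_lam (S - T)
  rw [hab]
  refine Finset.sum_eq_zero fun i _ => ?_
  obtain ⟨ω, hω⟩ := hb i
  rw [← hω, lam_sub, h, sub_self, TensorProduct.map_zero_right]

theorem rho_ext {S T : Op₂ H} (h : ∀ ω, rho S ω = rho T ω) : S = T := by
  rw [← sub_eq_zero]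
  obtain ⟨n, a, b, hab, hb⟩ := exists_rep_rho (S - T)
  rw [hab]
  refine Finset.sum_eq_zero fun i _ => ?_
  obtain ⟨ω, hω⟩ := hb i
  rw [← hω, rho_sub, h, sub_self, TensorProduct.map_zero_left]

theorem lam_map_mul (T : Op₂ H) (x : Op H) (ω : Module.Dual ℂ (Op H)) :
    lam (TensorProduct.map 1 x * T) ω = x * lam T ω := by
  obtain ⟨n, a, b, rfl⟩ := exists_rep T
  simp [Finset.mul_sum, ← TensorProduct.map_mul, lam_sum]

theorem lam_mul_map (T : Op₂ H) (x : Op H) (ω : Module.Dual ℂ (Op H)) :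
    lam (T * TensorProduct.map 1 x) ω = lam T ω * x := by
  obtain ⟨n, a, b, rfl⟩ := exists_rep T
  simp [Finset.sum_mul, ← TensorProduct.map_mul, lam_sum]

theorem rho_map_mul (T : Op₂ H) (x : Op H) (ω : Module.Dual ℂ (Op H)) :
    rho (TensorProduct.map x 1 * T) ω = x * rho T ω := by
  obtain ⟨n, a, b, rfl⟩ := exists_rep T
  simp [Finset.mul_sum, ← TensorProduct.map_mul, rho_sum]

theorem rho_mul_map (T : Op₂ H) (x : Op H) (ω : Module.Dual ℂ (Op H)) :
    rho (T * TensorProduct.map x 1) ω = rho T ω * x := by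
  obtain ⟨n, a, b, rfl⟩ := exists_rep T
  simp [Finset.sum_mul, ← TensorProduct.map_mul, rho_sum]

/-- Through this pairing, a functional annihilating the slices on one side becomes a vanishing slice
on the other. -/
theorem dual_lam (T : Op₂ H) (ω ψ : Module.Dual ℂ (Op H)) : ψ (lam T ω) = ω (rho T ψ) := by
  obtain ⟨n, a, b, rfl⟩ := exists_rep T
  simp [lam_sum, rho_sum, mul_comm]

/-- The functional `x ↦ conj (ω (x^*))`. -/
def conjDual (ω : Module.Dual ℂ (Op H)) : Module.Dual ℂ (Op H) where
  toFun x := star (ω (star x))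
  map_add' x y := by simp
  map_smul' c x := by simp

theorem conjDual_apply (ω : Module.Dual ℂ (Op H)) (x : Op H) :
    conjDual ω x = star (ω (star x)) := rfl

theorem star_lam (T : Op₂ H) (ω : Module.Dual ℂ (Op H)) :
    star (lam T ω) = lam (adj T) (conjDual ω) := by
  obtain ⟨n, a, b, rfl⟩ := exists_rep T
  simp [lam_sum, adj_sum, adj_map, conjDual_apply]

theorem star_rho (T : Op₂ H) (ω : Module.Dual ℂ (Op H)) :
    star (rho T ω) = rho (adj T) (conjDual ω) := by
  obtain ⟨n, a, b, rfl⟩ := exists_rep T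
  simp [rho_sum, adj_sum, adj_map, conjDual_apply]

theorem star_lam_adj (T : Op₂ H) (ω : Module.Dual ℂ (Op H)) :
    star (lam (adj T) ω) = lam T (conjDual ω) := by
  rw [star_lam, adj_adj]

theorem star_rho_adj (T : Op₂ H) (ω : Module.Dual ℂ (Op H)) :
    star (rho (adj T) ω) = rho T (conjDual ω) := by
  rw [star_rho, adj_adj]

theorem sandwich_map_mul (T : Op₂ H) (x X : Op H) :
    sandwich (TensorProduct.map 1 x * T) X = x * sandwich T X := by
  obtain ⟨n, a, b, rfl⟩ := exists_rep T
  simp [Finset.mul_sum, ← TensorProduct.map_mul, sandwich_sum, mul_assoc]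

theorem sandwich_mul_map (T : Op₂ H) (x X : Op H) :
    sandwich (T * TensorProduct.map x 1) X = sandwich T X * x := by
  obtain ⟨n, a, b, rfl⟩ := exists_rep T
  simp [Finset.sum_mul, ← TensorProduct.map_mul, sandwich_sum, mul_assoc]

/-- For `X` of rank one, built from a coordinate functional and a vector `ζ`, the values of
`sandwich T (r * X)` at `ξ` are the first-factor coordinates of `T (ξ ⊗ r ζ)`. -/
theorem mul_map_eq_zero_of_sandwich {T : Op₂ H} {r : Op H} (h : ∀ X, sandwich T (r * X) = 0) :
    T * TensorProduct.map 1 r = 0 := by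
  obtain ⟨n, a, b, rfl⟩ := exists_rep T
  let e := Module.finBasis ℂ H
  refine TensorProduct.ext' fun ξ ζ => ?_
  have key (k) : ∑ i, e.repr (a i ξ) k • b i (r ζ) = 0 := by
    have := LinearMap.congr_fun (h ((e.coord k).smulRight ζ)) ξ
    simpa [sandwich_sum] using this
  have : ∑ i, a i ξ ⊗ₜ[ℂ] b i (r ζ) = ∑ k, e k ⊗ₜ[ℂ] ∑ i, e.repr (a i ξ) k • b i (r ζ) := by
    simp only [TensorProduct.tmul_sum]
    rw [Finset.sum_comm]
    refine Finset.sum_congr rfl fun i _ => ?_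
    simp only [← TensorProduct.smul_tmul, ← TensorProduct.sum_tmul, e.sum_repr]
  simp [key] at this
  simpa using this

theorem map_mul_eq_zero_of_sandwich {T : Op₂ H} {r : Op H} (h : ∀ X, sandwich T (X * r) = 0) :
    TensorProduct.map r 1 * T = 0 := by
  obtain ⟨n, a, b, rfl⟩ := exists_rep T
  let e := Module.finBasis ℂ H
  refine TensorProduct.ext' fun ξ ζ => ?_
  have key (k) : ∑ i, e.repr (r (a i ξ)) k • b i ζ = 0 := by
    have := LinearMap.congr_fun (h ((e.coord k).smulRight ζ)) ξ
    simpa [sandwich_sum] using this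
  have : ∑ i, r (a i ξ) ⊗ₜ[ℂ] b i ζ = ∑ k, e k ⊗ₜ[ℂ] ∑ i, e.repr (r (a i ξ)) k • b i ζ := by
    simp only [TensorProduct.tmul_sum]
    rw [Finset.sum_comm]
    refine Finset.sum_congr rfl fun i _ => ?_
    simp only [← TensorProduct.smul_tmul, ← TensorProduct.sum_tmul, e.sum_repr]
  simp [key] at this
  simpa using this

/-! ### Units of the legs -/

theorem IsUnitOf.map_mul {V : Op₂ H} {e : Op H} (h : IsUnitOf (rightLeg V) e) :
    TensorProduct.map 1 e * V = V :=
  lam_ext fun ω => by rw [lam_map_mul, (h.2 _ ⟨ω, rfl⟩).1]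

theorem IsUnitOf.mul_map {V : Op₂ H} {e : Op H} (h : IsUnitOf (rightLeg V) e) :
    V * TensorProduct.map 1 e = V :=
  lam_ext fun ω => by rw [lam_mul_map, (h.2 _ ⟨ω, rfl⟩).2]

theorem IsUnitOf.map_mul_left {V : Op₂ H} {e : Op H} (h : IsUnitOf (leftLeg V) e) :
    TensorProduct.map e 1 * V = V :=
  rho_ext fun ω => by rw [rho_map_mul, (h.2 _ ⟨ω, rfl⟩).1]

theorem IsUnitOf.mul_map_left {V : Op₂ H} {e : Op H} (h : IsUnitOf (leftLeg V) e) :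
    V * TensorProduct.map e 1 = V :=
  rho_ext fun ω => by rw [rho_mul_map, (h.2 _ ⟨ω, rfl⟩).2]

omit [FiniteDimensional ℂ H] in
theorem IsUnitOf.unique {B : Submodule ℂ (Op H)} {e f : Op H} (he : IsUnitOf B e)
    (hf : IsUnitOf B f) : e = f := by
  rw [← (hf.2 e he.1).2, (he.2 f hf.1).1]

/-- The slice of an operator by a functional on the first tensor factor. -/
theorem exists_slice₁ (ω : Module.Dual ℂ (Op H)) : ∃ L : Op₃ H →ₗ[ℂ] Op₂ H,
    ∀ f g h, L (TensorProduct.map f (TensorProduct.map g h)) = ω f • TensorProduct.map g h :=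
  exists_linear₃ _
    (fun g h => ⟨fun x y => by simp [add_smul], fun c x => by simp [mul_smul]⟩)
    (fun f h => ⟨fun x y => by simp [TensorProduct.map_add_left],
      fun c x => by simp only [TensorProduct.map_smul_left]; exact smul_comm _ _ _⟩)
    (fun f g => ⟨fun x y => by simp [TensorProduct.map_add_right],
      fun c x => by simp only [TensorProduct.map_smul_right]; exact smul_comm _ _ _⟩)

/-- The slice of an operator by a functional on the third tensor factor. -/
theorem exists_slice₃ (ω : Module.Dual ℂ (Op H)) : ∃ L : Op₃ H →ₗ[ℂ] Op₂ H,
    ∀ f g h, L (TensorProduct.map f (TensorProduct.map g h)) = ω h • TensorProduct.map f g :=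
  exists_linear₃ _
    (fun g h => ⟨fun x y => by simp [TensorProduct.map_add_left],
      fun c x => by simp only [TensorProduct.map_smul_left]; exact smul_comm _ _ _⟩)
    (fun f h => ⟨fun x y => by simp [TensorProduct.map_add_right],
      fun c x => by simp only [TensorProduct.map_smul_right]; exact smul_comm _ _ _⟩)
    (fun f g => ⟨fun x y => by simp [add_smul], fun c x => by simp [mul_smul]⟩)

/-! ### Slices of products of legs -/

section Slice
variable {ω : Module.Dual ℂ (Op H)} {L : Op₃ H →ₗ[ℂ] Op₂ H}

theorem slice₁_leg13_mul_leg23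
    (hL : ∀ f g h, L (TensorProduct.map f (TensorProduct.map g h)) = ω f • TensorProduct.map g h)
    (S T : Op₂ H) : L (leg13 S * leg23 T) = TensorProduct.map 1 (lam S ω) * T := by
  obtain ⟨n, a, b, rfl⟩ := exists_rep S
  obtain ⟨m, c, d, rfl⟩ := exists_rep T
  simp [leg13_sum, leg23_sum, leg13_map, leg23_map, Finset.sum_mul_sum, ← TensorProduct.map_mul,
    hL, lam_sum, map_sum_right, TensorProduct.map_smul_right]

theorem slice₁_leg12_mul_leg13
    (hL : ∀ f g h, L (TensorProduct.map f (TensorProduct.map g h)) = ω f • TensorProduct.map g h)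
    (S T : Op₂ H) (x : Op H) :
    L (leg12 (S * TensorProduct.map 1 x) * leg13 T) =
      L (leg12 S * leg13 T) * TensorProduct.map x 1 := by
  obtain ⟨n, a, b, rfl⟩ := exists_rep S
  obtain ⟨m, c, d, rfl⟩ := exists_rep T
  simp [leg13_sum, leg12_sum, leg13_map, leg12_map, Finset.sum_mul, Finset.mul_sum,
    ← TensorProduct.map_mul, hL]

theorem slice₁_leg12_mul_leg23
    (hL : ∀ f g h, L (TensorProduct.map f (TensorProduct.map g h)) = ω f • TensorProduct.map g h)
    (S T : Op₂ H) : L (leg12 S * leg23 T) = TensorProduct.map (lam S ω) 1 * T := by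
  obtain ⟨n, a, b, rfl⟩ := exists_rep S
  obtain ⟨m, c, d, rfl⟩ := exists_rep T
  simp [leg12_sum, leg23_sum, leg12_map, leg23_map, Finset.sum_mul_sum, ← TensorProduct.map_mul,
    hL, lam_sum, map_sum_left, TensorProduct.map_smul_left]

theorem slice₁_leg23_mul_leg12
    (hL : ∀ f g h, L (TensorProduct.map f (TensorProduct.map g h)) = ω f • TensorProduct.map g h)
    (S T : Op₂ H) : L (leg23 T * leg12 S) = T * TensorProduct.map (lam S ω) 1 := by
  obtain ⟨n, a, b, rfl⟩ := exists_rep S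
  obtain ⟨m, c, d, rfl⟩ := exists_rep T
  simp [leg12_sum, leg23_sum, leg12_map, leg23_map, Finset.sum_mul_sum, ← TensorProduct.map_mul,
    hL, lam_sum, map_sum_left, TensorProduct.map_smul_left]

theorem slice₃_leg12_mul_leg13
    (hL : ∀ f g h, L (TensorProduct.map f (TensorProduct.map g h)) = ω h • TensorProduct.map f g)
    (S T : Op₂ H) : L (leg12 S * leg13 T) = S * TensorProduct.map (rho T ω) 1 := by
  obtain ⟨n, a, b, rfl⟩ := exists_rep S
  obtain ⟨m, c, d, rfl⟩ := exists_rep T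
  simp [leg12_sum, leg13_sum, leg12_map, leg13_map, Finset.sum_mul_sum, ← TensorProduct.map_mul,
    hL, rho_sum, map_sum_left, TensorProduct.map_smul_left]

theorem slice₃_leg13_mul_leg23
    (hL : ∀ f g h, L (TensorProduct.map f (TensorProduct.map g h)) = ω h • TensorProduct.map f g)
    (S T : Op₂ H) (x : Op H) :
    L (leg13 S * leg23 (TensorProduct.map x 1 * T)) =
      TensorProduct.map 1 x * L (leg13 S * leg23 T) := by
  obtain ⟨n, a, b, rfl⟩ := exists_rep S
  obtain ⟨m, c, d, rfl⟩ := exists_rep T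
  simp [leg13_sum, leg23_sum, leg13_map, leg23_map, Finset.sum_mul, Finset.mul_sum,
    ← TensorProduct.map_mul, hL]

theorem slice₃_leg12_mul_leg23
    (hL : ∀ f g h, L (TensorProduct.map f (TensorProduct.map g h)) = ω h • TensorProduct.map f g)
    (S T : Op₂ H) : L (leg12 S * leg23 T) = S * TensorProduct.map 1 (rho T ω) := by
  obtain ⟨n, a, b, rfl⟩ := exists_rep S
  obtain ⟨m, c, d, rfl⟩ := exists_rep T
  simp [leg12_sum, leg23_sum, leg12_map, leg23_map, Finset.sum_mul_sum, ← TensorProduct.map_mul,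
    hL, rho_sum, map_sum_right, TensorProduct.map_smul_right]

theorem slice₃_leg23_mul_leg12
    (hL : ∀ f g h, L (TensorProduct.map f (TensorProduct.map g h)) = ω h • TensorProduct.map f g)
    (S T : Op₂ H) : L (leg23 T * leg12 S) = TensorProduct.map 1 (rho T ω) * S := by
  obtain ⟨n, a, b, rfl⟩ := exists_rep S
  obtain ⟨m, c, d, rfl⟩ := exists_rep T
  simp [leg12_sum, leg23_sum, leg12_map, leg23_map, Finset.sum_mul_sum, ← TensorProduct.map_mul,
    hL, rho_sum, map_sum_right, TensorProduct.map_smul_right]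

end Slice

/-- Slicing the three hexagon axioms by the functionals that produce `e` and `f` shows how the units
interact with the projections `VV*` and `V*V`. Passing to adjoints and slicing once more gives `e* f
= f`, `f e* = e*` and `f e = e`. Hence `e* e = e* f e = e`, so `e` is self-adjoint, and the
remaining relation `f e = f` gives equality. -/
theorem IsMPI.units_eq {V : Op₂ H} (hV : IsMPI V) {e f : Op H} (he : IsUnitOf (rightLeg V) e)
    (hf : IsUnitOf (leftLeg V) f) : e = f ∧ star e = e := by
  obtain ⟨ω, hω⟩ := he.1
  obtain ⟨φ, hφ⟩ := hf.1
  obtain ⟨L₁, hL₁⟩ := exists_slice₁ ω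
  obtain ⟨L₃, hL₃⟩ := exists_slice₃ φ
  have he1 := he.map_mul
  have he2 := he.mul_map
  have hf1 := hf.map_mul_left
  have hf2 := hf.mul_map_left
  have hexa1 : leg13 V * leg23 (V * adj V) = leg12 (adj V * V) * leg13 V := by
    rw [leg23_mul, leg12_mul, ← hV.leg_hexa1, mul_assoc]
  have hexa2 : leg12 (V * adj V) * leg23 V = leg23 V * leg12 (V * adj V) := by
    rw [leg12_mul, hV.leg_hexa2, mul_assoc]
  have hexa3 : leg12 V * leg23 (adj V * V) = leg23 (adj V * V) * leg12 V := by
    rw [leg23_mul, ← hV.leg_hexa3, mul_assoc]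
  -- In the sliced first hexagon axiom one side is `(1 ⊗ e)VV* = VV*`; the other absorbs `e` on the
  -- right because `V(1 ⊗ e) = V`.
  have h1 : V * adj V * TensorProduct.map e 1 = V * adj V := by
    have h := congrArg L₁ hexa1
    rw [slice₁_leg13_mul_leg23 hL₁, hω, ← mul_assoc, he1] at h
    rw [h, ← slice₁_leg12_mul_leg13 hL₁, mul_assoc, he2]
  have h2 : TensorProduct.map 1 f * (adj V * V) = adj V * V := by
    have h := congrArg L₃ hexa1
    rw [slice₃_leg12_mul_leg13 hL₃, hφ, mul_assoc, hf2] at h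
    rw [← h, ← slice₃_leg13_mul_leg23 hL₃, ← mul_assoc, hf1]
  have h3 : V * adj V * TensorProduct.map 1 f = TensorProduct.map 1 f * (V * adj V) := by
    have h := congrArg L₃ hexa2
    rwa [slice₃_leg12_mul_leg23 hL₃, slice₃_leg23_mul_leg12 hL₃, hφ] at h
  have h4 : TensorProduct.map e 1 * (adj V * V) = adj V * V * TensorProduct.map e 1 := by
    have h := congrArg L₁ hexa3
    rwa [slice₁_leg12_mul_leg23 hL₁, slice₁_leg23_mul_leg12 hL₁, hω] at h
  have se_f : star e * f = f := by
    have h : TensorProduct.map (star e) 1 * V = V := by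
      have := congrArg adj h1
      simp only [adj_mul, adj_adj, adj_map, star_one] at this
      rw [← hV.mul_star_mul, ← mul_assoc, this]
    have := rho_map_mul V (star e) φ
    rwa [h, hφ, eq_comm] at this
  have e_sf : e * star f = e := by
    have h : V * TensorProduct.map 1 (star f) = V := by
      have := congrArg adj h2
      simp only [adj_mul, adj_adj, adj_map, star_one] at this
      conv_lhs => rw [← hV.mul_star_mul, mul_assoc V, mul_assoc V, this, ← mul_assoc, hV.mul_star_mul]
    have := lam_mul_map V (star f) ω
    rwa [h, hω, eq_comm] at this
  have f_se : f * star e = star e := by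
    have := congrArg star e_sf
    rwa [star_mul, star_star] at this
  have f_e : f * e = e := by
    have hP : V * adj V * TensorProduct.map 1 (star e) = V * adj V := by
      have := congrArg adj he1
      simp only [adj_mul, adj_map, star_one] at this
      rw [mul_assoc, this]
    have hfP : TensorProduct.map 1 f * (V * adj V) = V * adj V := by
      rw [← hP, ← mul_assoc, ← h3, mul_assoc, ← TensorProduct.map_mul, f_se, one_mul]
    have h : TensorProduct.map 1 f * V = V := by
      rw [← hV.mul_star_mul, ← mul_assoc, hfP]
    have := lam_map_mul V f ω
    rwa [h, hω, eq_comm] at this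
  have se_e : star e * e = e := by
    calc star e * e = star e * f * e := by rw [mul_assoc, f_e]
      _ = e := by rw [se_f, f_e]
  have se : star e = e := by rw [← se_e, star_mul, star_star]
  refine ⟨?_, se⟩
  rw [se] at se_f
  have hQf : adj V * V * TensorProduct.map f 1 = adj V * V := by rw [mul_assoc, hf2]
  -- `V*V` absorbs `f` on the right and commutes with `e ⊗ 1`, so `e f = f` makes it absorb `e` as
  -- well.
  have hQe : adj V * V * TensorProduct.map e 1 = adj V * V := by
    rw [← h4, ← hQf, ← mul_assoc, h4, mul_assoc, ← TensorProduct.map_mul, se_f, one_mul]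
  have h : V * TensorProduct.map e 1 = V := by
    conv_lhs => rw [← hV.mul_star_mul, mul_assoc V, mul_assoc V, hQe, ← mul_assoc, hV.mul_star_mul]
  have := rho_mul_map V e φ
  rw [h, hφ] at this
  rw [this, f_e]

/-! ### The legs are algebras -/

/-- A product of two slices is a slice of `V₁₃V₂₃ = V₁₂*V₂₃V₁₂`, whose third-factor entries all come
from `V₂₃` and hence from `A`. -/
theorem IsMPI.mul_mem_rightLeg {V : Op₂ H} (hV : IsMPI V) {x y : Op H} (hx : x ∈ rightLeg V)
    (hy : y ∈ rightLeg V) : x * y ∈ rightLeg V := by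
  obtain ⟨ω, rfl⟩ := hx
  obtain ⟨φ, rfl⟩ := hy
  obtain ⟨L, hL⟩ := exists_linear₃ (H := H) (fun f g h => (ω f * φ g) • h)
    (fun g h => ⟨fun x y => by simp [add_mul, add_smul], fun c x => by simp [mul_smul]⟩)
    (fun f h => ⟨fun x y => by simp [mul_add, add_smul],
      fun c x => by simp [mul_smul, mul_left_comm _ c]⟩)
    (fun f g => ⟨fun x y => by simp, fun c x => by simp [smul_comm c]⟩)
  have hl (S T : Op₂ H) : L (leg13 S * leg23 T) = lam S ω * lam T φ := by
    obtain ⟨n, a, b, rfl⟩ := exists_rep S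
    obtain ⟨m, c, d, rfl⟩ := exists_rep T
    simp only [leg13_sum, leg23_sum, leg13_map, leg23_map, Finset.sum_mul_sum, map_sum,
      ← TensorProduct.map_mul, hL, lam_sum, one_mul, mul_one, smul_mul_smul_comm]
  have hr (S T : Op₂ H) : L (leg12 S * leg23 V * leg12 T) ∈ rightLeg V := by
    obtain ⟨n, a, b, rfl⟩ := exists_rep S
    obtain ⟨m, c, d, rfl⟩ := exists_rep T
    obtain ⟨k, p, q, hV', hq⟩ := exists_rep_lam V
    have : leg23 V = leg23 (∑ i, TensorProduct.map (p i) (q i)) := congrArg _ hV'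
    simp only [this, leg12_sum, leg23_sum, leg12_map, leg23_map, Finset.sum_mul, Finset.mul_sum,
      ← TensorProduct.map_mul, hL, map_sum, one_mul, mul_one]
    exact Submodule.sum_mem _ fun i _ => Submodule.sum_mem _ fun j _ => Submodule.sum_mem _
      fun k _ => Submodule.smul_mem _ _ (hq _)
  rw [← hl, hV.leg13_mul_leg23]
  exact hr _ _

theorem IsMPI.mul_mem_leftLeg {V : Op₂ H} (hV : IsMPI V) {x y : Op H} (hx : x ∈ leftLeg V)
    (hy : y ∈ leftLeg V) : x * y ∈ leftLeg V := by
  obtain ⟨ω, rfl⟩ := hx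
  obtain ⟨φ, rfl⟩ := hy
  obtain ⟨L, hL⟩ := exists_linear₃ (H := H) (fun f g h => (ω g * φ h) • f)
    (fun f g => ⟨fun x y => by simp, fun c x => by simp [smul_comm c]⟩)
    (fun g h => ⟨fun x y => by simp [add_mul, add_smul], fun c x => by simp [mul_smul]⟩)
    (fun f h => ⟨fun x y => by simp [mul_add, add_smul],
      fun c x => by simp [mul_smul, mul_left_comm _ c]⟩)
  have hl (S T : Op₂ H) : L (leg12 S * leg13 T) = rho S ω * rho T φ := by
    obtain ⟨n, a, b, rfl⟩ := exists_rep S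
    obtain ⟨m, c, d, rfl⟩ := exists_rep T
    simp only [leg12_sum, leg13_sum, leg12_map, leg13_map, Finset.sum_mul_sum, map_sum,
      ← TensorProduct.map_mul, hL, rho_sum, one_mul, mul_one, smul_mul_smul_comm]
  have hr (S T : Op₂ H) : L (leg23 S * leg12 V * leg23 T) ∈ leftLeg V := by
    obtain ⟨n, a, b, rfl⟩ := exists_rep S
    obtain ⟨m, c, d, rfl⟩ := exists_rep T
    obtain ⟨k, p, q, hV', hp⟩ := exists_rep_rho V
    have : leg12 V = leg12 (∑ i, TensorProduct.map (p i) (q i)) := congrArg _ hV'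
    simp only [this, leg12_sum, leg23_sum, leg12_map, leg23_map, Finset.sum_mul, Finset.mul_sum,
      ← TensorProduct.map_mul, hL, map_sum, one_mul, mul_one]
    exact Submodule.sum_mem _ fun i _ => Submodule.sum_mem _ fun j _ => Submodule.sum_mem _
      fun k _ => Submodule.smul_mem _ _ (hp _)
  rw [← hl, hV.leg12_mul_leg13]
  exact hr _ _

theorem isStarSubalgebra_of_mem {B : Submodule ℂ (Op H)} (hmul : ∀ x ∈ B, ∀ y ∈ B, x * y ∈ B)
    (hstar : ∀ x ∈ B, star x ∈ B) : IsStarSubalgebra B :=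
  ⟨{ B with
      mul_mem' := fun {x y} hx hy => hmul x hx y hy
      star_mem' := fun {x} hx => hstar x hx }, rfl⟩

theorem IsStarSubalgebra.mul_mem {B : Submodule ℂ (Op H)} (hB : IsStarSubalgebra B) {x y : Op H}
    (hx : x ∈ B) (hy : y ∈ B) : x * y ∈ B := by
  obtain ⟨S, hS⟩ := hB
  simp only [← SetLike.mem_coe, ← hS] at *
  exact S.mul_mem hx hy

theorem IsStarSubalgebra.star_mem {B : Submodule ℂ (Op H)} (hB : IsStarSubalgebra B) {x : Op H}
    (hx : x ∈ B) : star x ∈ B := by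
  obtain ⟨S, hS⟩ := hB
  simp only [← SetLike.mem_coe, ← hS] at *
  exact S.star_mem' hx

/-! ### Regularity implies that the legs are closed under the adjoint -/

/-- Both sides are the image of `V₁₂V₂₃* = V₂₃*V₁₂V₁₃` under `f ⊗ g ⊗ h ↦ ω(g X f) h`. Taking
adjoints of the operator on the right only replaces `sandwich V X` by its adjoint. -/
theorem IsMPI.lam_adj_sandwich {V : Op₂ H} (hV : IsMPI V) (X : Op H)
    (ω : Module.Dual ℂ (Op H)) :
    lam (adj V) (ω ∘ₗ sandwich V ∘ₗ LinearMap.mulRight ℂ X) =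
      lam (adj V * TensorProduct.map (sandwich V X) 1 * V) ω := by
  obtain ⟨L, hL⟩ := exists_linear₃ (H := H) (fun f g h => ω (g * (X * f)) • h)
    (fun g h => ⟨fun x y => by simp [mul_add, add_smul], fun c x => by simp [mul_smul]⟩)
    (fun f h => ⟨fun x y => by simp [add_mul, add_smul], fun c x => by simp [mul_smul]⟩)
    (fun f g => ⟨fun x y => by simp, fun c x => by simp [smul_comm c]⟩)
  have hl (S T : Op₂ H) : L (leg12 S * leg23 T) =
      lam T (ω ∘ₗ sandwich S ∘ₗ LinearMap.mulRight ℂ X) := by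
    obtain ⟨n, a, b, rfl⟩ := exists_rep S
    obtain ⟨m, c, d, rfl⟩ := exists_rep T
    simp only [leg12_sum, leg23_sum, leg12_map, leg23_map, Finset.sum_mul,
      Finset.mul_sum, ← TensorProduct.map_mul, hL, map_sum, one_mul, mul_one,
      lam_sum, sandwich_sum, LinearMap.comp_apply, LinearMap.mulRight_apply, Finset.sum_smul,
      mul_assoc]
  have hr (S T U : Op₂ H) : L (leg23 S * leg12 T * leg13 U) =
      lam (S * TensorProduct.map (sandwich T X) 1 * U) ω := by
    obtain ⟨n, a, b, rfl⟩ := exists_rep S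
    obtain ⟨m, c, d, rfl⟩ := exists_rep T
    obtain ⟨k, p, q, rfl⟩ := exists_rep U
    simp only [leg12_sum, leg13_sum, leg23_sum, leg12_map, leg13_map, leg23_map,
      Finset.sum_mul, Finset.mul_sum, ← TensorProduct.map_mul, hL, map_sum, map_sum_left,
      one_mul, mul_one, sandwich_sum, mul_assoc, lam_finset_sum, lam_map]
  rw [← hl, ← hr, hV.leg12_mul_leg23_star]

theorem IsMPI.rho_adj_sandwich {V : Op₂ H} (hV : IsMPI V) (X : Op H)
    (ω : Module.Dual ℂ (Op H)) :
    rho (adj V) (ω ∘ₗ sandwich V ∘ₗ LinearMap.mulLeft ℂ X) =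
      rho (V * TensorProduct.map 1 (sandwich V X) * adj V) ω := by
  obtain ⟨L, hL⟩ := exists_linear₃ (H := H) (fun f g h => ω (h * (X * g)) • f)
    (fun f g => ⟨fun x y => by simp, fun c x => by simp [smul_comm c]⟩)
    (fun g h => ⟨fun x y => by simp [mul_add, add_smul], fun c x => by simp [mul_smul]⟩)
    (fun f h => ⟨fun x y => by simp [add_mul, add_smul], fun c x => by simp [mul_smul]⟩)
  have hl (S T : Op₂ H) : L (leg12 T * leg23 S) =
      rho T (ω ∘ₗ sandwich S ∘ₗ LinearMap.mulLeft ℂ X) := by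
    obtain ⟨n, a, b, rfl⟩ := exists_rep S
    obtain ⟨m, c, d, rfl⟩ := exists_rep T
    simp only [leg12_sum, leg23_sum, leg12_map, leg23_map, Finset.sum_mul,
      Finset.mul_sum, ← TensorProduct.map_mul, hL, map_sum, one_mul, mul_one,
      rho_sum, sandwich_sum, LinearMap.comp_apply, LinearMap.mulLeft_apply, Finset.sum_smul,
      mul_assoc]
    exact Finset.sum_comm
  have hr (S T U : Op₂ H) : L (leg13 S * leg23 T * leg12 U) =
      rho (S * TensorProduct.map 1 (sandwich T X) * U) ω := by
    obtain ⟨n, a, b, rfl⟩ := exists_rep S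
    obtain ⟨m, c, d, rfl⟩ := exists_rep T
    obtain ⟨k, p, q, rfl⟩ := exists_rep U
    simp only [leg12_sum, leg13_sum, leg23_sum, leg12_map, leg13_map, leg23_map,
      Finset.sum_mul, Finset.mul_sum, ← TensorProduct.map_mul, hL, map_sum, map_sum_right,
      one_mul, mul_one, sandwich_sum, mul_assoc, rho_finset_sum, rho_map]
  rw [← hl, ← hr, hV.leg12_star_mul_leg23]

/-- If some adjoint were outside `A`, a functional `ψ` would separate it from `A`. Since `ψ` kills
the slices of `mem`, the element `r = rho (adj V) ψ` satisfies `V(1 ⊗ r) = 0`, so `e r = 0`; but `e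
r = r`, and `r = 0` contradicts the separation. -/
theorem IsMPI.star_mem_rightLeg {V : Op₂ H} (hV : IsMPI V) {e : Op H}
    (he : IsUnitOf (rightLeg V) e) (hf : IsUnitOf (leftLeg V) e) (hse : star e = e)
    (hC : ∀ Y ∈ C V, star Y ∈ C V) {x : Op H} (hx : x ∈ rightLeg V) : star x ∈ rightLeg V := by
  obtain ⟨φ, rfl⟩ := hx
  by_contra hnot
  obtain ⟨ψ, hψ, hker⟩ := Submodule.exists_le_ker_of_notMem hnot
  -- The adjoint of this slice of `V*` is again a slice of `V*`, with `X'` in place of `X`; one more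
  -- adjoint gives a slice of `V`.
  have mem (X : Op H) (ω : Module.Dual ℂ (Op H)) :
      lam (adj V) (ω ∘ₗ sandwich V ∘ₗ LinearMap.mulRight ℂ X) ∈ rightLeg V := by
    obtain ⟨X', hX'⟩ := hC _ ⟨X, rfl⟩
    have h : adj (adj V * TensorProduct.map (sandwich V X) 1 * V) =
        adj V * TensorProduct.map (sandwich V X') 1 * V := by
      simp only [adj_mul, adj_adj, adj_map, star_one, hX', mul_assoc]
    rw [hV.lam_adj_sandwich, ← star_star (lam _ ω), star_lam, h, ← hV.lam_adj_sandwich,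
      star_lam_adj]
    exact ⟨_, rfl⟩
  have hr : e * rho (adj V) ψ = 0 := by
    have h0 : V * TensorProduct.map 1 (rho (adj V) ψ) = 0 := by
      refine mul_map_eq_zero_of_sandwich fun X => ?_
      rw [← Module.forall_dual_apply_eq_zero_iff ℂ]
      intro ω
      have := hker (mem X ω)
      rwa [LinearMap.mem_ker, dual_lam] at this
    obtain ⟨ω, rfl⟩ := he.1
    rw [← lam_mul_map, h0]
    simp [lam, toTensor]
  have hr' : e * rho (adj V) ψ = rho (adj V) ψ := by
    have h : TensorProduct.map e 1 * adj V = adj V := by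
      have := congrArg adj hf.mul_map_left
      rwa [adj_mul, adj_map, hse, star_one] at this
    rw [← rho_map_mul, h]
  apply hψ
  rw [star_lam, dual_lam, ← hr', hr, map_zero]

theorem IsMPI.star_mem_leftLeg {V : Op₂ H} (hV : IsMPI V) {e : Op H}
    (he : IsUnitOf (rightLeg V) e) (hf : IsUnitOf (leftLeg V) e) (hse : star e = e)
    (hC : ∀ Y ∈ C V, star Y ∈ C V) {x : Op H} (hx : x ∈ leftLeg V) : star x ∈ leftLeg V := by
  obtain ⟨φ, rfl⟩ := hx
  by_contra hnot
  obtain ⟨ψ, hψ, hker⟩ := Submodule.exists_le_ker_of_notMem hnot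
  have mem (X : Op H) (ω : Module.Dual ℂ (Op H)) :
      rho (adj V) (ω ∘ₗ sandwich V ∘ₗ LinearMap.mulLeft ℂ X) ∈ leftLeg V := by
    obtain ⟨X', hX'⟩ := hC _ ⟨X, rfl⟩
    have h : adj (V * TensorProduct.map 1 (sandwich V X) * adj V) =
        V * TensorProduct.map 1 (sandwich V X') * adj V := by
      simp only [adj_mul, adj_adj, adj_map, star_one, hX', mul_assoc]
    rw [hV.rho_adj_sandwich, ← star_star (rho _ ω), star_rho, h, ← hV.rho_adj_sandwich,
      star_rho_adj]
    exact ⟨_, rfl⟩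
  have hr : lam (adj V) ψ * e = 0 := by
    have h0 : TensorProduct.map (lam (adj V) ψ) 1 * V = 0 := by
      refine map_mul_eq_zero_of_sandwich fun X => ?_
      rw [← Module.forall_dual_apply_eq_zero_iff ℂ]
      intro ω
      have := hker (mem X ω)
      rwa [LinearMap.mem_ker, ← dual_lam] at this
    obtain ⟨ω, rfl⟩ := hf.1
    rw [← rho_map_mul, h0]
    simp [rho, toTensor]
  have hr' : lam (adj V) ψ * e = lam (adj V) ψ := by
    have h : adj V * TensorProduct.map 1 e = adj V := by
      have := congrArg adj he.map_mul
      rwa [adj_mul, adj_map, hse, star_one] at this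
    rw [← lam_mul_map, h]
  apply hψ
  rw [star_rho, ← dual_lam, ← hr', hr, map_zero]

theorem star_mem_AR {V : Op₂ H} {x : Op H} (hx : x ∈ AR V) : star x ∈ AR V := by
  obtain ⟨ω, rfl⟩ := hx
  refine ⟨conjDual ω, ?_⟩
  rw [star_lam, adj_mul, adj_adj]

theorem IsRegular.star_mem_C {V : Op₂ H} {e : Op H} (h : IsRegular V)
    (he : IsUnitOf (rightLeg V) e) (hse : star e = e) {Y : Op H} (hY : Y ∈ C V) :
    star Y ∈ C V := by
  obtain ⟨e', he', hC⟩ := h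
  obtain rfl := he.unique he'
  simp only [← SetLike.mem_coe, hC] at hY ⊢
  obtain ⟨hY, T, rfl⟩ := hY
  refine ⟨fun x hx => ?_, star T, by simp [hse, mul_assoc]⟩
  have := congrArg star (hY (star x) (star_mem_AR hx))
  simpa only [star_mul, star_star] using this.symm

theorem IsMPI.isStarSubalgebra_legs {V : Op₂ H} (hV : IsMPI V) (hu : IsUnital V)
    (hr : IsRegular V) : IsStarSubalgebra (rightLeg V) ∧ IsStarSubalgebra (leftLeg V) := by
  obtain ⟨ε, ε', he, hf⟩ := hu
  obtain ⟨hef, hse⟩ := hV.units_eq he hf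
  rw [← hef] at hf
  have hC : ∀ Y ∈ C V, star Y ∈ C V := fun Y => hr.star_mem_C he hse
  exact ⟨isStarSubalgebra_of_mem (fun x hx y => hV.mul_mem_rightLeg hx)
      fun x => hV.star_mem_rightLeg he hf hse hC,
    isStarSubalgebra_of_mem (fun x hx y => hV.mul_mem_leftLeg hx)
      fun x => hV.star_mem_leftLeg he hf hse hC⟩

/-! ### Star closed legs are unital and regular -/

theorem eq_zero_of_sum_star_mul_self {ι : Type*} {s : Finset ι} {c : ι → Op H}
    (h : ∑ i ∈ s, star (c i) * c i = 0) {i : ι} (hi : i ∈ s) : c i = 0 := by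
  ext ξ
  have h1 : ∑ j ∈ s, ‖c j ξ‖ ^ 2 = 0 := by
    have h2 : inner ℂ ((∑ j ∈ s, star (c j) * c j) ξ) ξ = 0 := by rw [h]; simp
    have h3 : ((∑ j ∈ s, ‖c j ξ‖ ^ 2 : ℝ) : ℂ) = 0 := by
      rw [← h2, LinearMap.sum_apply, sum_inner]
      push_cast
      refine Finset.sum_congr rfl fun j _ => ?_
      rw [Module.End.mul_apply, LinearMap.star_eq_adjoint, LinearMap.adjoint_inner_left,
        inner_self_eq_norm_sq_to_K]
      rfl
    exact_mod_cast h3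
  have := (Finset.sum_eq_zero_iff_of_nonneg fun j _ => by positivity).1 h1 i hi
  simpa using this

/-- With `T = ∑ cᵢ* cᵢ` over a basis of `B`, positivity makes left multiplication by `T` injective
on `B`, hence surjective. A solution of `T e = T` is a left unit by cancellation, and its adjoint is
a right unit. -/
theorem IsStarSubalgebra.exists_unit {B : Submodule ℂ (Op H)} (hB : IsStarSubalgebra B) :
    ∃ e, IsUnitOf B e := by
  let c := Module.finBasis ℂ B
  let T : Op H := ∑ i, star (c i : Op H) * c i
  have hT : T ∈ B := Submodule.sum_mem _ fun i _ => hB.mul_mem (hB.star_mem (c i).2) (c i).2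
  have inj : ∀ x ∈ B, T * x = 0 → x = 0 := by
    intro x hx h
    have h1 : ∀ i, (c i : Op H) * x = 0 := fun i =>
      eq_zero_of_sum_star_mul_self (s := Finset.univ) (c := fun i => (c i : Op H) * x) (by
        have h2 := congrArg (star x * ·) h
        simpa only [T, star_mul, Finset.sum_mul, Finset.mul_sum, mul_zero, mul_assoc] using h2)
        (Finset.mem_univ i)
    have h2 : ∀ y : B, (y : Op H) * x = 0 := by
      intro y
      rw [← c.sum_repr y, Submodule.coe_sum, Finset.sum_mul]
      exact Finset.sum_eq_zero fun i _ => by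
        rw [Submodule.coe_smul, smul_mul_assoc, h1, smul_zero]
    have h3 := h2 ⟨star x, hB.star_mem hx⟩
    exact eq_zero_of_sum_star_mul_self (s := {()}) (c := fun _ : Unit => x) (i := ())
      (by simpa using h3) (by simp)
  let M : B →ₗ[ℂ] B := (LinearMap.mulLeft ℂ T).restrict fun x hx => hB.mul_mem hT hx
  have hM : Function.Injective M := by
    rw [← LinearMap.ker_eq_bot, LinearMap.ker_eq_bot']
    intro x hx
    exact Subtype.ext (inj x x.2 (congrArg Subtype.val hx))
  obtain ⟨e, he⟩ := (LinearMap.injective_iff_surjective.1 hM) ⟨T, hT⟩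
  have he : T * (e : Op H) = T := congrArg Subtype.val he
  have left : ∀ y ∈ B, (e : Op H) * y = y := by
    intro y hy
    rw [← sub_eq_zero]
    refine inj _ (B.sub_mem (hB.mul_mem e.2 hy) hy) ?_
    rw [mul_sub, ← mul_assoc, he, sub_self]
  have right : ∀ y ∈ B, y * star (e : Op H) = y := by
    intro y hy
    simpa using congrArg star (left _ (hB.star_mem hy))
  have hse : star (e : Op H) = e := by
    rw [← left _ (hB.star_mem e.2), right _ e.2]
  exact ⟨e, e.2, fun b hb => ⟨left b hb, by simpa only [hse] using right b hb⟩⟩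

theorem IsUnital.of_isStarSubalgebra {V : Op₂ H} (hA : IsStarSubalgebra (rightLeg V))
    (hB : IsStarSubalgebra (leftLeg V)) : IsUnital V := by
  obtain ⟨e, he⟩ := hA.exists_unit
  obtain ⟨f, hf⟩ := hB.exists_unit
  obtain ⟨ε', rfl⟩ := he.1
  obtain ⟨ε, rfl⟩ := hf.1
  exact ⟨ε, ε', he, hf⟩

theorem IsMPI.lam_mul_sandwich {V : Op₂ H} (hV : IsMPI V) (X : Op H)
    (ω : Module.Dual ℂ (Op H)) :
    lam (adj V * V) ω * sandwich V X = sandwich V X * lam (adj V * V) ω := by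
  obtain ⟨L, hL⟩ := exists_linear₃ (H := H) (fun f g h => ω f • (h * (X * g)))
    (fun f g => ⟨fun x y => by simp [add_smul], fun c x => by simp [mul_smul]⟩)
    (fun g h => ⟨fun x y => by simp [mul_add], fun c x => by simp [smul_comm c]⟩)
    (fun f h => ⟨fun x y => by simp [add_mul], fun c x => by simp [smul_comm c]⟩)
  have hl (S T : Op₂ H) : L (leg13 S * leg23 T) = lam S ω * sandwich T X := by
    obtain ⟨n, a, b, rfl⟩ := exists_rep S
    obtain ⟨m, c, d, rfl⟩ := exists_rep T
    simp only [leg13_sum, leg23_sum, leg13_map, leg23_map, Finset.sum_mul_sum, map_sum,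
      ← TensorProduct.map_mul, hL, lam_sum, sandwich_sum, one_mul, mul_one, smul_mul_assoc,
      mul_assoc]
  have hr (S T : Op₂ H) : L (leg23 T * leg12 S) = sandwich T X * lam S ω := by
    obtain ⟨n, a, b, rfl⟩ := exists_rep S
    obtain ⟨m, c, d, rfl⟩ := exists_rep T
    simp only [leg12_sum, leg23_sum, leg12_map, leg23_map, Finset.sum_mul_sum, map_sum,
      ← TensorProduct.map_mul, hL, lam_sum, sandwich_sum, one_mul, mul_one, mul_smul_comm,
      mul_assoc]
  rw [← hl, ← hr, leg13_mul, leg12_mul, hV.leg13_star_mul_leg13_mul_leg23]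

/-- The linear map `S` on the first tensor factor of an operator on `H ⊗ K`. -/
theorem exists_map_left {K : Type*} [AddCommGroup K] [Module ℂ K] [FiniteDimensional ℂ K]
    (S : Op H →ₗ[ℂ] Op H) :
    ∃ L : (H ⊗[ℂ] K →ₗ[ℂ] H ⊗[ℂ] K) →ₗ[ℂ] (H ⊗[ℂ] K →ₗ[ℂ] H ⊗[ℂ] K),
      ∀ f T, L (TensorProduct.map f T) = TensorProduct.map (S f) T := by
  refine ⟨(homTensorHomEquiv ℂ H K H K).toLinearMap ∘ₗ S.rTensor _ ∘ₗ
    (homTensorHomEquiv ℂ H K H K).symm.toLinearMap, fun f T => ?_⟩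
  have h : (homTensorHomEquiv ℂ H K H K).symm (TensorProduct.map f T) = f ⊗ₜ T := by
    rw [LinearEquiv.symm_apply_eq, homTensorHomEquiv_tmul]
  simp only [LinearMap.comp_apply, LinearEquiv.coe_coe, h, LinearMap.rTensor_tmul,
    homTensorHomEquiv_tmul]

/-- The inverse of the antipode of the left leg: the map `S` with `(S ⊗ id)(V^*) = V`. -/
theorem exists_antipode {V : Op₂ H} (hA : IsStarSubalgebra (rightLeg V)) :
    ∃ S : Op H →ₗ[ℂ] Op H, ∀ ω, S (rho (adj V) ω) = rho V ω := by
  -- Both kernels are annihilators, of `A*` and of `A`, and `A ⊆ A*`.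
  have hker : LinearMap.ker (rho (adj V)) ≤ LinearMap.ker (rho V) := by
    intro ψ hψ
    rw [LinearMap.mem_ker] at hψ ⊢
    rw [← Module.forall_dual_apply_eq_zero_iff ℂ]
    intro φ
    obtain ⟨φ', hφ'⟩ := hA.star_mem ⟨φ, rfl⟩
    have h : lam V φ = lam (adj V) (conjDual φ') := by rw [← star_lam, hφ', star_star]
    rw [← dual_lam, h, dual_lam, hψ, map_zero]
  -- The map is forced only on slices of `V*`; its extension to `L(H)` is arbitrary.
  obtain ⟨g, hg⟩ := LinearMap.exists_extend
    ((LinearMap.ker (rho (adj V))).liftQ (rho V) hker ∘ₗ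
      (rho (adj V)).quotKerEquivRange.symm.toLinearMap)
  refine ⟨g, fun ω => ?_⟩
  have := LinearMap.congr_fun hg ⟨rho (adj V) ω, ω, rfl⟩
  simp only [LinearMap.comp_apply, Submodule.subtype_apply, LinearEquiv.coe_coe] at this
  rw [this]
  have h : (rho (adj V)).quotKerEquivRange.symm ⟨rho (adj V) ω, ω, rfl⟩ =
      Submodule.Quotient.mk ω := by
    rw [LinearEquiv.symm_apply_eq]; rfl
  rw [h]
  rfl

/-! ### Antimultiplicativity of the antipode -/

section Antipode
variable {V : Op₂ H} {S : Op H →ₗ[ℂ] Op H} (hS : ∀ ω, S (rho (adj V) ω) = rho V ω)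
include hS

theorem antipode_map_left {L : Op₂ H →ₗ[ℂ] Op₂ H}
    (hL : ∀ f T, L (TensorProduct.map f T) = TensorProduct.map (S f) T) : L (adj V) = V := by
  refine rho_ext fun ω => ?_
  rw [← hS]
  obtain ⟨n, a, b, h⟩ := exists_rep (adj V)
  simp only [h, map_sum, hL, rho_sum, map_smul]

/-- Applying `S` to the first factor of `V₁₃*V₁₂* = V₂₃V₁₂*V₂₃*` affects only `V₁₂*` on the right
and gives `V₂₃V₁₂V₂₃* = V₁₂V₁₃`: the order of the product is reversed. -/
theorem IsMPI.antipode_mul (hV : IsMPI V) (ω φ : Module.Dual ℂ (Op H)) :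
    S (rho (adj V) ω * rho (adj V) φ) = S (rho (adj V) φ) * S (rho (adj V) ω) := by
  obtain ⟨L₂, hL₂⟩ := exists_map_left (K := H) S
  obtain ⟨L₃, hL₃⟩ := exists_map_left (K := H ⊗[ℂ] H) S
  obtain ⟨Φ, hΦ⟩ := exists_linear₃ (H := H) (fun f g h => (φ g * ω h) • f)
    (fun f g => ⟨fun x y => by simp, fun c x => by simp [smul_comm c]⟩)
    (fun g h => ⟨fun x y => by simp [add_mul, add_smul], fun c x => by simp [mul_smul]⟩)
    (fun f h => ⟨fun x y => by simp [mul_add, add_smul],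
      fun c x => by simp [mul_smul, mul_left_comm _ c]⟩)
  have h₁ (T U : Op₂ H) : Φ (L₃ (leg13 T * leg12 U)) = S (rho T ω * rho U φ) := by
    obtain ⟨n, a, b, rfl⟩ := exists_rep T
    obtain ⟨m, c, d, rfl⟩ := exists_rep U
    simp only [leg13_sum, leg12_sum, leg13_map, leg12_map, Finset.sum_mul_sum, map_sum,
      ← TensorProduct.map_mul, hL₃, hΦ, rho_sum, one_mul, mul_one, smul_mul_smul_comm, map_smul,
      mul_comm (φ _)]
  have h₂ (T U : Op₂ H) : Φ (leg12 T * leg13 U) = rho T φ * rho U ω := by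
    obtain ⟨n, a, b, rfl⟩ := exists_rep T
    obtain ⟨m, c, d, rfl⟩ := exists_rep U
    simp only [leg13_sum, leg12_sum, leg13_map, leg12_map, Finset.sum_mul_sum, map_sum,
      ← TensorProduct.map_mul, hΦ, rho_sum, one_mul, mul_one, smul_mul_smul_comm]
  have h₃ (T U W : Op₂ H) : L₃ (leg23 T * leg12 U * leg23 W) =
      leg23 T * leg12 (L₂ U) * leg23 W := by
    obtain ⟨n, a, b, rfl⟩ := exists_rep T
    obtain ⟨m, c, d, rfl⟩ := exists_rep U
    obtain ⟨k, p, q, rfl⟩ := exists_rep W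
    simp only [leg23_sum, leg12_sum, leg23_map, leg12_map, Finset.sum_mul, Finset.mul_sum, map_sum,
      ← TensorProduct.map_mul, hL₂, hL₃, one_mul, mul_one]
  rw [← h₁, hV.leg13_star_mul_leg12_star, h₃, antipode_map_left hS hL₂, ← hV.leg12_mul_leg13, h₂,
    hS, hS]

end Antipode

/-! ### Star closed legs are regular -/

theorem leftLeg_adj {V : Op₂ H} (hB : IsStarSubalgebra (leftLeg V)) {x : Op H}
    (hx : x ∈ leftLeg V) : ∃ ω, rho (adj V) ω = x := by
  obtain ⟨φ, hφ⟩ := hB.star_mem hx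
  exact ⟨conjDual φ, by rw [← star_rho, hφ, star_star]⟩

theorem rho_adj_mem {V : Op₂ H} (hB : IsStarSubalgebra (leftLeg V))
    (ω : Module.Dual ℂ (Op H)) : rho (adj V) ω ∈ leftLeg V := by
  rw [← star_star (rho (adj V) ω), star_rho_adj]
  exact hB.star_mem ⟨_, rfl⟩

theorem exists_rep_adj {V : Op₂ H} (hB : IsStarSubalgebra (leftLeg V)) :
    ∃ (n : ℕ) (a b : Fin n → Op H),
      adj V = ∑ i, TensorProduct.map (a i) (b i) ∧ ∀ i, a i ∈ leftLeg V := by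
  obtain ⟨n, a, b, h, ha⟩ := exists_rep_rho (adj V)
  refine ⟨n, a, b, h, fun i => ?_⟩
  obtain ⟨ω, hω⟩ := ha i
  exact hω ▸ rho_adj_mem hB ω

theorem rho_mem_of_adj_mul {V : Op₂ H} (hB : IsStarSubalgebra (leftLeg V))
    (ω : Module.Dual ℂ (Op H)) : rho (adj V * V) ω ∈ leftLeg V := by
  obtain ⟨n, a, b, h, ha⟩ := exists_rep_adj hB
  obtain ⟨m, c, d, h', hc⟩ := exists_rep_rho V
  have : adj V * V = ∑ i, ∑ j, TensorProduct.map (a i * c j) (b i * d j) := by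
    rw [h]
    conv_lhs => rw [h']
    simp only [Finset.sum_mul_sum, ← TensorProduct.map_mul]
  simp only [this, rho_finset_sum, rho_map]
  exact Submodule.sum_mem _ fun i _ => Submodule.sum_mem _ fun j _ =>
    Submodule.smul_mem _ _ (hB.mul_mem (ha i) (hc j))

theorem IsMPI.antipode_mul_of_mem {V : Op₂ H} (hV : IsMPI V)
    (hB : IsStarSubalgebra (leftLeg V)) {S : Op H →ₗ[ℂ] Op H}
    (hS : ∀ ω, S (rho (adj V) ω) = rho V ω) {x y : Op H} (hx : x ∈ leftLeg V)
    (hy : y ∈ leftLeg V) : S (x * y) = S y * S x := by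
  obtain ⟨ω, rfl⟩ := leftLeg_adj hB hx
  obtain ⟨φ, rfl⟩ := leftLeg_adj hB hy
  exact hV.antipode_mul hS ω φ

/-- If `(S ⊗ id)(V^*) = V` with `S` antimultiplicative and `V^* V = ∑ w ⊗ w'`, then the element
`z = ∑ w' S(w)` satisfies `V (z ⊗ 1) = V`. -/
theorem IsMPI.mul_map_antipode {V : Op₂ H} (hV : IsMPI V)
    (hB : IsStarSubalgebra (leftLeg V)) {S : Op H →ₗ[ℂ] Op H}
    (hS : ∀ ω, S (rho (adj V) ω) = rho V ω) {L : Op₂ H →ₗ[ℂ] Op H}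
    (hL : ∀ f g, L (TensorProduct.map f g) = g * S f) :
    V * TensorProduct.map (L (adj V * V)) 1 = V := by
  obtain ⟨L₂, hL₂⟩ := exists_map_left (K := H) S
  have hLV := antipode_map_left hS hL₂
  obtain ⟨Φ, hΦ⟩ := exists_linear₃ (H := H) (fun f g h => TensorProduct.map (g * S f) h)
    (fun g h => ⟨fun x y => by simp [mul_add, TensorProduct.map_add_left],
      fun c x => by simp [TensorProduct.map_smul_left]⟩)
    (fun f h => ⟨fun x y => by simp [add_mul, TensorProduct.map_add_left],
      fun c x => by simp [TensorProduct.map_smul_left]⟩)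
    (fun f g => ⟨fun x y => by simp [TensorProduct.map_add_right],
      fun c x => by simp [TensorProduct.map_smul_right]⟩)
  have h₁ (T U : Op₂ H) : Φ (leg23 T * leg12 U) = T * TensorProduct.map (L U) 1 := by
    obtain ⟨n, a, b, rfl⟩ := exists_rep T
    obtain ⟨m, c, d, rfl⟩ := exists_rep U
    simp only [leg23_sum, leg12_sum, leg23_map, leg12_map, Finset.sum_mul, Finset.mul_sum,
      map_sum, map_sum_left, ← TensorProduct.map_mul, hL, hΦ, one_mul, mul_one, mul_assoc]
  -- Antimultiplicativity on `Â` splits `S(w a)` as `S(a) S(w)`, where `V* = ∑ a ⊗ b`; this needs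
  -- `w` and `a` in `Â`, hence the representations by slices.
  have h₂ : L₂ (adj V * V * adj V) = Φ (leg13 (adj V * V) * leg23 (L₂ (adj V))) := by
    obtain ⟨n, a, b, h, ha⟩ := exists_rep_adj hB
    obtain ⟨m, c, d, h', hc⟩ := exists_rep_rho (adj V * V)
    have hc : ∀ i, c i ∈ leftLeg V := fun i => by
      obtain ⟨ω, hω⟩ := hc i
      exact hω ▸ rho_mem_of_adj_mul hB ω
    rw [h', h]
    simp only [leg23_sum, leg13_sum, leg23_map, leg13_map, Finset.sum_mul_sum, map_sum,
      ← TensorProduct.map_mul, hL₂, hΦ, one_mul, mul_one]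
    exact Finset.sum_congr rfl fun i _ => Finset.sum_congr rfl fun j _ => by
      rw [hV.antipode_mul_of_mem hB hS (hc i) (ha j)]
  rw [hV.star_mul_mul_star, hLV, leg13_mul, hV.leg13_star_mul_leg13_mul_leg23, ← leg12_mul,
    h₁] at h₂
  exact h₂.symm

/-- Write `V* = ∑ a ⊗ b` and `V = ∑ c ⊗ d`. Then `Y = Y z = ∑ Y b d S(a c)`, and commutation with
`A^R` turns this into `∑ b d Y S(c) S(a)`. As `V = ∑ S(a) ⊗ b`, this is `V₂XV₁` with `X = ∑ d Y
S(c)`, the element `M V`. -/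
theorem IsMPI.mem_C_of_commute {V : Op₂ H} (hV : IsMPI V)
    (hA : IsStarSubalgebra (rightLeg V)) (hB : IsStarSubalgebra (leftLeg V)) {e Y : Op H}
    (he : IsUnitOf (leftLeg V) e) (hYe : Y * e = Y) (hY : ∀ x ∈ AR V, x * Y = Y * x) :
    Y ∈ C V := by
  obtain ⟨S, hS⟩ := exists_antipode hA
  obtain ⟨L, hL⟩ := exists_linear₂ (H := H) (fun f g => g * S f)
    (fun g => ⟨fun x y => by simp [mul_add], fun c x => by simp⟩)
    (fun f => ⟨fun x y => by simp [add_mul], fun c x => by simp⟩)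
  obtain ⟨M, hM⟩ := exists_linear₂ (H := H) (fun f g => g * (Y * S f))
    (fun g => ⟨fun x y => by simp [mul_add], fun c x => by simp⟩)
    (fun f => ⟨fun x y => by simp [add_mul], fun c x => by simp⟩)
  obtain ⟨L₂, hL₂⟩ := exists_map_left (K := H) S
  have hLV := antipode_map_left hS hL₂
  -- Slicing `V(z ⊗ 1) = V` to the unit gives `e z = e`, and `Y` absorbs `e`.
  have hz : Y * L (adj V * V) = Y := by
    obtain ⟨ω, hω⟩ := he.1
    have h := congrArg (fun T => rho T ω) (hV.mul_map_antipode hB hS hL)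
    simp only [rho_mul_map, hω] at h
    rw [← hYe, mul_assoc, h]
  have h₁ : M (adj V * V) = Y * L (adj V * V) := by
    obtain ⟨n, a, b, h, hb⟩ := exists_rep_lam (adj V * V)
    rw [h]
    simp only [map_sum, hM, hL, Finset.mul_sum]
    exact Finset.sum_congr rfl fun i _ => by rw [← mul_assoc, hY _ (hb i), mul_assoc]
  have h₂ : sandwich (L₂ (adj V)) (M V) = M (adj V * V) := by
    obtain ⟨n, a, b, h, ha⟩ := exists_rep_adj hB
    obtain ⟨m, c, d, h', hc⟩ := exists_rep_rho V
    rw [h]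
    conv_lhs => rw [h']
    conv_rhs => rw [h']
    simp only [map_sum, hL₂, hM, sandwich_sum, ← TensorProduct.map_mul,
      Finset.mul_sum, Finset.sum_mul]
    exact Finset.sum_congr rfl fun i _ => Finset.sum_congr rfl fun j _ => by
      rw [hV.antipode_mul_of_mem hB hS (ha j) (hc i)]; simp only [mul_assoc]
  exact ⟨M V, by rw [hLV] at h₂; rw [h₂, h₁, hz]⟩

theorem IsMPI.isRegular {V : Op₂ H} (hV : IsMPI V) (hA : IsStarSubalgebra (rightLeg V))
    (hB : IsStarSubalgebra (leftLeg V)) : IsRegular V := by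
  obtain ⟨e, he⟩ := hA.exists_unit
  obtain ⟨f, hf⟩ := hB.exists_unit
  obtain ⟨rfl, -⟩ := hV.units_eq he hf
  refine ⟨e, he, Set.Subset.antisymm ?_ ?_⟩
  · rintro _ ⟨X, rfl⟩
    refine ⟨?_, sandwich V X, ?_⟩
    · rintro _ ⟨ω, rfl⟩
      exact hV.lam_mul_sandwich X ω
    · rw [← sandwich_map_mul, ← sandwich_mul_map, he.map_mul, hf.mul_map_left]
  · rintro Y ⟨hY, T, rfl⟩
    refine hV.mem_C_of_commute hA hB hf ?_ hY
    rw [mul_assoc, (hf.2 e hf.1).1]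

end MPI
end
theorem mainTheorem1 {H : Type*} [NormedAddCommGroup H] [InnerProductSpace ℂ H]
    [FiniteDimensional ℂ H] (V : MPI.Op₂ H) (hV : MPI.IsMPI V) :
    (MPI.IsStarSubalgebra (MPI.rightLeg V) ∧ MPI.IsStarSubalgebra (MPI.leftLeg V)) ↔
      (MPI.IsUnital V ∧ MPI.IsRegular V) :=
  ⟨fun h => ⟨.of_isStarSubalgebra h.1 h.2, hV.isRegular h.1 h.2⟩,
    fun h => hV.isStarSubalgebra_legs h.1 h.2⟩
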